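/- Let $n, m \ge 0$ be integers and let $\mathcal S^n := \{u \in \mathbb R^n : u_1 \le \cdots \le u_n\}$ denote the monotone cone. Let $I_1,\dots,I_m$ be a partition of $\{1,\dots,n\}$ into nonempty blocks of consecutive integers, listed in increasing order, and let $$\mathcal S_{|I_1|,\dots,|I_m|} := \{u \in \mathcal S^n : u \text{ is constant on each of } I_1,\dots,I_m\}$$ be the block monotone cone. For a closed convex set $C \subseteq \mathbb R^n$ let $\Pi_C(z)$ denote the Euclidean projection of $z$ onto $C$ (the unique point of $C$ nearest to $z$), and for a closed convex cone $T \subseteq \mathbb R^n$ let $\delta(T) := \mathbb E\,\|\Pi_T(Z)\|^2$ with $Z \sim N(0, I_n)$ be its statistical dimension. For every $z \in \mathbb R^n$, writing $\bar z_{I_j} := \frac{1}{|I_j|}\sum_{i \in I_j} z_i$, the projection $\Pi_{\mathcal S_{|I_1|,\dots,|I_m|}}(z)$ is the vector that is constant on the blocks $I_1,\dots,I_m$ with values $x^*_1,\dots,x^*_m$, where $$x^* = (x_1^*,\dots,x_m^*) = \operatorname*{argmin}_{x \in \mathcal S^m} \sum_{j=1}^m |I_j|\,(x_j - \bar z_{I_j})^2$$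 is the unique minimizer; that is, the block values are the weighted isotonic regression of the block means $(\bar z_{I_1},\dots,\bar z_{I_m})$ with weights $|I_1|,\dots,|I_m|$. Consequently, if $|I_1| = \cdots = |I_m|$, then $\|\Pi_{\mathcal S_{|I_1|,\dots,|I_m|}}(Z)\|^2$ is integrable for $Z \sim N(0, I_n)$ and $$\delta(\mathcal S_{|I_1|,\dots,|I_m|}) = \sum_{j=1}^m \frac1j =: H_m .$$ -/

import Mathlib

open MeasureTheory ProbabilityTheory

/-- `x = argmin_{y ∈ S} f y`: `x` lies in `S` and is the unique minimizer of `f` over `S`. -/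
def IsArgmin {α : Type*} (f : α → ℝ) (S : Set α) (x : α) : Prop :=
  x ∈ S ∧ ∀ y ∈ S, y ≠ x → f x < f y

/-- The Euclidean projection `Π_C(z)`: the unique point of `C` nearest to `z`
(it exists whenever `C` is nonempty, closed and convex; arbitrary if there is none). -/
noncomputable def euclideanProj {n : ℕ} (C : Set (EuclideanSpace ℝ (Fin n)))
    (z : EuclideanSpace ℝ (Fin n)) : EuclideanSpace ℝ (Fin n) :=
  Classical.epsilon (IsArgmin (fun v => ‖v - z‖) C)

/-- The statistical dimension `δ(T) = 𝔼 ‖Π_T(Z)‖²`, where `Z ∼ N(0, I_n)`. -/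
noncomputable def statDim {n : ℕ} (T : Set (EuclideanSpace ℝ (Fin n))) : ℝ :=
  ∫ z, ‖euclideanProj T z‖ ^ 2 ∂(stdGaussian (EuclideanSpace ℝ (Fin n)))

/-- The monotone cone `{u ∈ ℝⁿ : u₁ ≤ ⋯ ≤ uₙ}`. -/
def monotoneCone (n : ℕ) : Set (EuclideanSpace ℝ (Fin n)) :=
  {u | ∀ a b : Fin n, a ≤ b → u a ≤ u b}

/-- `I₁, …, Iₘ` is a partition of the `n` indices into (nonempty) blocks of consecutive indices,
listed in increasing order. -/
structure IsBlockPartition {n m : ℕ} (I : Fin m → Finset (Fin n)) : Prop where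
  isBlock : ∀ j, ∃ k l : Fin n, k ≤ l ∧ I j = Finset.Icc k l
  increasing : ∀ i j, i < j → ∀ a ∈ I i, ∀ b ∈ I j, a < b
  cover : ∀ a, ∃ j, a ∈ I j

/-- The block monotone cone: nondecreasing vectors that are constant on each block. -/
def blockMonotoneCone {n m : ℕ} (I : Fin m → Finset (Fin n)) : Set (EuclideanSpace ℝ (Fin n)) :=
  {u | u ∈ monotoneCone n ∧ ∀ j, ∀ a ∈ I j, ∀ b ∈ I j, u a = u b}

/-- The mean of the entries of `z` over the index set `J`. -/
noncomputable def blockMean {n : ℕ} (z : EuclideanSpace ℝ (Fin n)) (J : Finset (Fin n)) : ℝ :=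
  (1 / (J.card : ℝ)) * ∑ i ∈ J, z i

/-- `x` is the weighted isotonic regression of `y` with weights `w`:
`x = argmin_{x ∈ S^m} ∑ⱼ wⱼ (xⱼ - yⱼ)²`. -/
def IsWeightedIsotonicRegression {m : ℕ} (w y : Fin m → ℝ) (x : EuclideanSpace ℝ (Fin m)) : Prop :=
  IsArgmin (fun x : EuclideanSpace ℝ (Fin m) => ∑ j, w j * (x j - y j) ^ 2) (monotoneCone m) x

/-! On each block the deviations of `z` from its mean sum to zero, so by Pythagoras the squared
distance from `z` to a block-constant vector is the weighted isotonic objective plus a constant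
(`norm_blockVec_sub_sq`). If all blocks have size `b`, the block means times `√b` form a standard
Gaussian vector in dimension `m`, and the squared norm of the projection is that of its projection
onto the monotone cone; this reduces the claim to `statDim_monotoneCone`.

For that cone, the projection of `z` consists of the slopes of the greatest convex minorant of the
walk of partial sums of `z`. A face of length `l` with increment `D` contributes `D ^ 2 / l` to the
squared norm (`sum_sq_eq_sum_faces`). For fixed `l`, exchangeability moves the steps below the face
to the end of the walk; with `c` their mean slope, the face starts at `i` iff these steps stay above
their chord and `i` is the strict minimizer of `S k - c * k` over the remaining walk. Exactly one
`i` qualifies almost surely (`sum_integral_face`). Among the `l` cyclic rotations of these steps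
exactly one stays above the chord, almost surely, and rotation preserves `D`
(`integral_bridge_nonneg`). Since `D` has variance `l`, length `l` contributes `1 / l` in
expectation. -/

/-! ### Isotonic fits and the faces of the greatest convex minorant -/

/-- The segment over `[i, j]` is a maximal face of the greatest convex minorant of the walk `S`
on `{0, …, m}`. -/
def IsFace (S : ℕ → ℝ) (m i j : ℕ) : Prop :=
  i < j ∧ j ≤ m ∧ ∀ k ≤ m,
    S i + (S j - S i) / ((j : ℝ) - i) * ((k : ℝ) - i) ≤ S k ∧
    ((k < i ∨ j < k) → S i + (S j - S i) / ((j : ℝ) - i) * ((k : ℝ) - i) < S k)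

/-- The walk `S` and the nondecreasing sequence `u` on `{0, …, m - 1}` satisfy the optimality
conditions of isotonic regression: the partial sums of `u` form a convex minorant of `S` that
touches `S` at the end points and wherever `u` jumps. -/
structure IsIsotonicFit (S u : ℕ → ℝ) (m : ℕ) : Prop where
  mono : ∀ a b, a ≤ b → b < m → u a ≤ u b
  zero : S 0 = 0
  le : ∀ k ≤ m, ∑ a ∈ Finset.range k, u a ≤ S k
  last : ∑ a ∈ Finset.range m, u a = S m
  jump : ∀ k, k + 1 < m → u k < u (k + 1) → ∑ a ∈ Finset.range (k + 1), u a = S (k + 1)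

/-- Applied to sublevel sets of a nondecreasing sequence, this yields the end points of its level
sets. -/
theorem exists_threshold (m : ℕ) (P : ℕ → Prop) (hP : ∀ a b, a ≤ b → b < m → P b → P a) :
    ∃ p ≤ m, ∀ a < m, (a < p ↔ P a) := by
  classical
  have hex : ∃ p, m ≤ p ∨ ¬ P p := ⟨m, Or.inl le_rfl⟩
  refine ⟨Nat.find hex, Nat.find_min' hex (Or.inl le_rfl), fun a ha => ⟨fun h => ?_, fun h => ?_⟩⟩
  · have := Nat.find_min hex h
    push Not at this
    exact this.2
  · by_contra hlt
    push Not at hlt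
    rcases Nat.find_spec hex with h1 | h1
    · omega
    · exact h1 (hP _ _ hlt ha h)

theorem sum_range_ge_of_le (u : ℕ → ℝ) (c : ℝ) {p k : ℕ} (hpk : p ≤ k)
    (h : ∀ a, p ≤ a → a < k → c ≤ u a) :
    ∑ a ∈ Finset.range p, u a + c * ((k : ℝ) - p) ≤ ∑ a ∈ Finset.range k, u a := by
  have h1 := Finset.sum_Ico_eq_sub u hpk
  have h2 : ∑ a ∈ Finset.Ico p k, c ≤ ∑ a ∈ Finset.Ico p k, u a :=
    Finset.sum_le_sum fun a ha => h a (Finset.mem_Ico.1 ha).1 (Finset.mem_Ico.1 ha).2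
  rw [Finset.sum_const, Nat.card_Ico, nsmul_eq_mul, Nat.cast_sub hpk] at h2
  linarith

theorem sum_range_gt_of_lt (u : ℕ → ℝ) (c : ℝ) {p k : ℕ} (hpk : p < k)
    (h : ∀ a, p ≤ a → a < k → c < u a) :
    ∑ a ∈ Finset.range p, u a + c * ((k : ℝ) - p) < ∑ a ∈ Finset.range k, u a := by
  have h1 := Finset.sum_Ico_eq_sub u hpk.le
  have h2 : ∑ a ∈ Finset.Ico p k, c < ∑ a ∈ Finset.Ico p k, u a :=
    Finset.sum_lt_sum_of_nonempty (Finset.nonempty_Ico.2 hpk)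
      fun a ha => h a (Finset.mem_Ico.1 ha).1 (Finset.mem_Ico.1 ha).2
  rw [Finset.sum_const, Nat.card_Ico, nsmul_eq_mul, Nat.cast_sub hpk.le] at h2
  linarith

theorem sum_range_lt_of_lt (u : ℕ → ℝ) (c : ℝ) {p k : ℕ} (hpk : p < k)
    (h : ∀ a, p ≤ a → a < k → u a < c) :
    ∑ a ∈ Finset.range k, u a < ∑ a ∈ Finset.range p, u a + c * ((k : ℝ) - p) := by
  have := sum_range_gt_of_lt (fun a => - u a) (-c) hpk (fun a h1 h2 => neg_lt_neg (h a h1 h2))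
  simp only [Finset.sum_neg_distrib] at this
  linarith

theorem sum_range_eq_of_eq (u : ℕ → ℝ) (c : ℝ) {p k : ℕ} (hpk : p ≤ k)
    (h : ∀ a, p ≤ a → a < k → u a = c) :
    ∑ a ∈ Finset.range k, u a = ∑ a ∈ Finset.range p, u a + c * ((k : ℝ) - p) := by
  have h1 := sum_range_ge_of_le u c hpk (fun a h1 h2 => (h a h1 h2).ge)
  have h2 := sum_range_ge_of_le (fun a => - u a) (-c) hpk
    (fun a h1 h2 => neg_le_neg (h a h1 h2).le)
  simp only [Finset.sum_neg_distrib] at h2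
  linarith

namespace IsIsotonicFit

variable {S u : ℕ → ℝ} {m : ℕ}

/-- The threshold `p` is an end point of the range or a place where `u` jumps. -/
theorem touch (h : IsIsotonicFit S u m) {P : ℕ → Prop} {p : ℕ} (hp : p ≤ m)
    (hP : ∀ a < m, (a < p ↔ P a)) (hPu : ∀ a b, P a → ¬ P b → u a < u b) :
    ∑ a ∈ Finset.range p, u a = S p := by
  rcases Nat.eq_zero_or_pos p with rfl | h0
  · simp [h.zero]
  rcases hp.eq_or_lt with rfl | hlt
  · exact h.last
  obtain ⟨k, rfl⟩ : ∃ k, p = k + 1 := ⟨p - 1, by omega⟩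
  refine h.jump k hlt (hPu _ _ ((hP k (by omega)).1 (by omega)) ?_)
  rw [← hP (k + 1) hlt]
  omega

/-- The level set of `u` at height `c` is the set of points where `S` touches its supporting line
of slope `c`. -/
theorem level (h : IsIsotonicFit S u m) {c : ℝ} {p q : ℕ} (hpm : p ≤ m) (hqm : q ≤ m)
    (hp : ∀ a < m, (a < p ↔ u a < c)) (hq : ∀ a < m, (a < q ↔ u a ≤ c)) :
    p ≤ q ∧ S q = S p + c * ((q : ℝ) - p) ∧ ∀ k ≤ m, S p + c * ((k : ℝ) - p) ≤ S k ∧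
      ((k < p ∨ q < k) → S p + c * ((k : ℝ) - p) < S k) := by
  have hpq : p ≤ q := by
    by_contra hlt
    push Not at hlt
    have := (hq q (by omega)).2 ((hp q (by omega)).1 hlt).le
    omega
  have hGp := h.touch hpm hp (fun a b h1 h2 => h1.trans_le (not_lt.1 h2))
  have hGq := h.touch hqm hq (fun a b h1 h2 => h1.trans_lt (not_le.1 h2))
  have heq : S q = S p + c * ((q : ℝ) - p) := by
    rw [← hGp, ← hGq]
    refine sum_range_eq_of_eq u c hpq fun a h1 h2 => le_antisymm ((hq a (by omega)).1 h2) ?_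
    by_contra hlt
    have := (hp a (by omega)).2 (not_le.1 hlt)
    omega
  -- Since `u < c` before `p` and `u > c` from `q` on, the partial sums of `u`, and hence `S`, lie
  -- strictly above the line outside `[p, q]`.
  have hstrict : ∀ k ≤ m, (k < p ∨ q < k) → S p + c * ((k : ℝ) - p) < S k := by
    rintro k hk (hkp | hqk)
    · have h1 := sum_range_lt_of_lt u c hkp (fun a _ h2 => (hp a (by omega)).1 h2)
      have h2 := h.le k hk
      linarith
    · have h1 := sum_range_gt_of_lt u c hqk (fun a h1 h2 => by
        by_contra hlt
        have := (hq a (by omega)).2 (not_lt.1 hlt)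
        omega)
      have h2 := h.le k hk
      linarith
  refine ⟨hpq, heq, fun k hk => ⟨?_, hstrict k hk⟩⟩
  by_cases hkp : k < p
  · exact (hstrict k hk (Or.inl hkp)).le
  · have h1 := sum_range_ge_of_le u c (not_lt.1 hkp) (fun a h1 h2 => by
      by_contra hlt
      have := (hp a (by omega)).2 (not_le.1 hlt)
      omega)
    have h2 := h.le k hk
    linarith

theorem isFace_of_level (h : IsIsotonicFit S u m) {c : ℝ} {p q : ℕ} (hpm : p ≤ m) (hqm : q ≤ m)
    (hp : ∀ a < m, (a < p ↔ u a < c)) (hq : ∀ a < m, (a < q ↔ u a ≤ c)) (hpq : p < q) :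
    IsFace S m p q := by
  obtain ⟨-, heq, hk⟩ := h.level hpm hqm hp hq
  have hc : (S q - S p) / ((q : ℝ) - p) = c := by
    have : (p : ℝ) < q := by exact_mod_cast hpq
    rw [div_eq_iff (by linarith)]
    linarith
  refine ⟨hpq, hqm, ?_⟩
  rw [hc]
  exact hk

/-- The face and the level set of `u` at the slope of the face are both the full range between
contacts of `S` with a supporting line of that slope. Two such parallel lines coincide, hence so do
the end points. -/
theorem level_of_isFace (h : IsIsotonicFit S u m) {i j : ℕ} (hf : IsFace S m i j) :
    (∀ a < m, (a < i ↔ u a < (S j - S i) / ((j : ℝ) - i))) ∧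
      ∀ a < m, (a < j ↔ u a ≤ (S j - S i) / ((j : ℝ) - i)) := by
  obtain ⟨hij, hjm, hk⟩ := hf
  have hSj : S j = S i + (S j - S i) / ((j : ℝ) - i) * ((j : ℝ) - i) := by
    have : (i : ℝ) < j := by exact_mod_cast hij
    rw [div_mul_cancel₀ _ (by linarith)]
    ring
  set c := (S j - S i) / ((j : ℝ) - i) with hc
  obtain ⟨p, hpm, hp⟩ := exists_threshold m (fun a => u a < c)
    (fun a b hab hb hlt => (h.mono a b hab hb).trans_lt hlt)
  obtain ⟨q, hqm, hq⟩ := exists_threshold m (fun a => u a ≤ c)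
    (fun a b hab hb hlt => (h.mono a b hab hb).trans hlt)
  obtain ⟨hpq, heq, hl⟩ := h.level hpm hqm hp hq
  have hi : ¬ (i < p ∨ q < i) := fun hcon => by
    have h1 := (hl i (by omega)).2 hcon
    have h2 := (hk p hpm).1
    linarith
  have hj : ¬ (j < p ∨ q < j) := fun hcon => by
    have h1 := (hl j (by omega)).2 hcon
    have h2 := (hk p hpm).1
    linarith
  have hp' : ¬ (p < i ∨ j < p) := fun hcon => by
    have h1 := (hk p hpm).2 hcon
    have h2 := (hl i (by omega)).1
    linarith
  have hq' : ¬ (q < i ∨ j < q) := fun hcon => by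
    have h1 := (hk q hqm).2 hcon
    have h2 := (hl i (by omega)).1
    linarith
  obtain rfl : p = i := by omega
  obtain rfl : q = j := by omega
  exact ⟨hp, hq⟩

-- Faces are the nonempty level sets of `u`; on one of length `l`, `u` is constantly the increment
-- divided by `l`.
open Classical in
theorem sum_sq_eq_sum_faces (h : IsIsotonicFit S u m) :
    ∑ a ∈ Finset.range m, u a ^ 2 = ∑ l ∈ Finset.Icc 1 m, ∑ i ∈ Finset.range (m - l + 1),
      if IsFace S m i (i + l) then (S (i + l) - S i) ^ 2 / (l : ℝ) else 0 := by
  have hface : ∀ l i, (if IsFace S m i (i + l) then (S (i + l) - S i) ^ 2 / (l : ℝ) else 0) =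
      ∑ a ∈ Finset.range m, if IsFace S m i (i + l) ∧ i ≤ a ∧ a < i + l then u a ^ 2 else 0 := by
    intro l i
    by_cases hf : IsFace S m i (i + l)
    · obtain ⟨hp, hq⟩ := h.level_of_isFace hf
      have hl : (0 : ℝ) < l := by
        have := hf.1
        exact_mod_cast (by omega : 0 < l)
      have hlen : (((i + l : ℕ) : ℝ) - i) = l := by push_cast; ring
      rw [hlen] at hp hq
      simp only [hf, true_and, if_true]
      rw [← Finset.sum_filter]
      have hset : (Finset.range m).filter (fun a => i ≤ a ∧ a < i + l) = Finset.Ico i (i + l) := by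
        ext a
        have := hf.2.1
        simp only [Finset.mem_filter, Finset.mem_range, Finset.mem_Ico]
        omega
      rw [hset, Finset.sum_congr rfl (g := fun _ => ((S (i + l) - S i) / (l : ℝ)) ^ 2)]
      · rw [Finset.sum_const, Nat.card_Ico, nsmul_eq_mul, Nat.add_sub_cancel_left]
        field_simp
      · intro a ha
        obtain ⟨h1, h2⟩ := Finset.mem_Ico.1 ha
        have := hf.2.1
        congr 1
        refine le_antisymm ((hq a (by omega)).1 h2) ?_
        by_contra hlt
        have := (hp a (by omega)).2 (not_le.1 hlt)
        omega
    · simp [hf]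
  simp_rw [hface]
  rw [Finset.sum_sigma', Finset.sum_comm]
  refine Finset.sum_congr rfl fun a ha => ?_
  rw [Finset.mem_range] at ha
  obtain ⟨p, hpm, hp⟩ := exists_threshold m (fun b => u b < u a)
    (fun x y hab hb hlt => (h.mono x y hab hb).trans_lt hlt)
  obtain ⟨q, hqm, hq⟩ := exists_threshold m (fun b => u b ≤ u a)
    (fun x y hab hb hlt => (h.mono x y hab hb).trans hlt)
  have hpa : p ≤ a := by
    by_contra hlt
    exact lt_irrefl _ ((hp a ha).1 (not_le.1 hlt))
  have haq : a < q := (hq a ha).2 le_rfl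
  have hf := h.isFace_of_level hpm hqm hp hq (by omega)
  -- With the sums exchanged, `a` lies in one face only: the level set of `u` at height `u a`.
  rw [Finset.sum_eq_single (⟨q - p, p⟩ : (_ : ℕ) × ℕ)]
  · have : p + (q - p) = q := by omega
    simp only [this]
    rw [if_pos ⟨hf, hpa, haq⟩]
  · rintro ⟨l, i⟩ - hne
    refine if_neg ?_
    rintro ⟨hf', h1, h2⟩
    obtain ⟨hp', hq'⟩ := h.level_of_isFace hf'
    have hc : u a = (S (i + l) - S i) / (((i + l : ℕ) : ℝ) - i) := by
      refine le_antisymm ((hq' a ha).1 h2) ?_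
      by_contra hlt
      have := (hp' a ha).2 (not_le.1 hlt)
      omega
    rw [← hc] at hp' hq'
    have him := hf'.2.1
    dsimp only at *
    have e1 : i = p := by
      by_contra hne
      rcases lt_or_gt_of_ne hne with hlt | hlt
      · have := (hp' i (by omega)).2 ((hp i (by omega)).1 hlt)
        omega
      · have := (hp p (by omega)).2 ((hp' p (by omega)).1 hlt)
        omega
    have e2 : i + l = q := by
      by_contra hne
      rcases lt_or_gt_of_ne hne with hlt | hlt
      · have := (hq' (i + l) (by omega)).2 ((hq (i + l) (by omega)).1 hlt)
        omega
      · have := (hq q (by omega)).2 ((hq' q (by omega)).1 hlt)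
        omega
    refine hne ?_
    subst e1
    have : l = q - i := by omega
    rw [this]
  · intro hmem
    refine absurd ?_ hmem
    simp only [Finset.mem_sigma, Finset.mem_Icc, Finset.mem_range]
    omega

end IsIsotonicFit

/-! ### Unique minimizers and Gaussian linear functionals -/

-- Used twice: to single out the starting position of a face, and to single out a rotation.
open Classical in
theorem sum_ite_argmin (W : ℕ → ℝ) {N : ℕ} (hN : 0 < N)
    (hW : Set.InjOn W (Finset.range N)) (x : ℝ) :
    ∑ i ∈ Finset.range N, (if ∀ k < N, W i ≤ W k then x else 0) = x := by
  obtain ⟨i, hi, hmin⟩ := Finset.exists_min_image (Finset.range N) W ⟨0, Finset.mem_range.2 hN⟩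
  rw [Finset.sum_eq_single_of_mem i hi]
  · exact if_pos fun k hk => hmin k (Finset.mem_range.2 hk)
  · intro j hj hne
    refine if_neg fun hall => hne (hW hj hi ?_)
    exact le_antisymm (hall i (Finset.mem_range.1 hi)) (hmin j hj)

/-- A map between Euclidean spaces whose adjoint is isometric preserves the standard Gaussian. -/
theorem measurePreserving_stdGaussian_of_inner {E F : Type*}
    [NormedAddCommGroup E] [InnerProductSpace ℝ E] [FiniteDimensional ℝ E] [MeasurableSpace E]
    [BorelSpace E] [NormedAddCommGroup F] [InnerProductSpace ℝ F] [FiniteDimensional ℝ F]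
    [MeasurableSpace F] [BorelSpace F] (T : E → F) (T' : F → E) (hT : Measurable T)
    (hadj : ∀ z t, inner ℝ (T z) t = inner ℝ z (T' t)) (hnorm : ∀ t, ‖T' t‖ = ‖t‖) :
    MeasurePreserving T (stdGaussian E) (stdGaussian F) := by
  refine ⟨hT, ?_⟩
  have : IsProbabilityMeasure ((stdGaussian E).map T) :=
    Measure.isProbabilityMeasure_map hT.aemeasurable
  -- The image has at `t` the characteristic function of the source at `T' t`, and the Gaussian one
  -- depends on the norm only.
  apply Measure.ext_of_charFun
  ext t
  rw [charFun_stdGaussian, ← hnorm t, ← charFun_stdGaussian (T' t), charFun_apply, charFun_apply,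
    integral_map hT.aemeasurable (Measurable.aestronglyMeasurable (by fun_prop))]
  simp_rw [hadj]

section Functional

variable {E : Type*} [NormedAddCommGroup E] [InnerProductSpace ℝ E] [FiniteDimensional ℝ E]
  [MeasurableSpace E] [BorelSpace E]

theorem integrable_inner_sq_stdGaussian (a : E) :
    Integrable (fun z => inner ℝ a z ^ 2) (stdGaussian E) :=
  (IsGaussian.memLp_dual (stdGaussian E) (innerSL ℝ a) 2 (by simp)).integrable_sq

theorem integral_inner_sq_stdGaussian (a : E) :
    ∫ z, inner ℝ a z ^ 2 ∂(stdGaussian E) = ‖a‖ ^ 2 := by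
  have h := variance_dual_stdGaussian (innerSL ℝ a)
  rw [variance_of_integral_eq_zero (by fun_prop) (integral_strongDual_stdGaussian _),
    innerSL_apply_norm] at h
  exact h

/-- The functional has a Gaussian law of variance `‖a‖ ^ 2 > 0`, hence no atoms. All almost sure
uniqueness below comes from this. -/
theorem ae_inner_ne_zero_stdGaussian {a : E} (ha : a ≠ 0) :
    ∀ᵐ z ∂(stdGaussian E), inner ℝ a z ≠ 0 := by
  have hmap := IsGaussian.map_eq_gaussianReal (μ := stdGaussian E) (innerSL ℝ a)
  rw [variance_dual_stdGaussian, innerSL_apply_norm] at hmap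
  have hv : (‖a‖ ^ 2).toNNReal ≠ 0 := by
    simpa using ha
  have := nullSingletonClass_gaussianReal (μ := ∫ z, innerSL ℝ a z ∂(stdGaussian E)) hv
  have h0 : (stdGaussian E).map (innerSL ℝ a) {0} = 0 := by
    rw [hmap]
    exact measure_singleton 0
  rw [Measure.map_apply (by fun_prop) (measurableSet_singleton 0)] at h0
  rw [ae_iff]
  convert h0 using 2
  ext z
  simp

end Functional

/-! ### The Gaussian random walk -/

section Walk

variable {m : ℕ}

/-- The coordinates of `z` as a sequence, extended by zero. -/
noncomputable def zeroExtend (z : EuclideanSpace ℝ (Fin m)) (k : ℕ) : ℝ :=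
  if h : k < m then z ⟨k, h⟩ else 0

/-- The partial sums of the coordinates of `z`. -/
noncomputable def walk (z : EuclideanSpace ℝ (Fin m)) (k : ℕ) : ℝ :=
  ∑ a ∈ Finset.range k, zeroExtend z a

/-- The vector with coordinates `z (τ k)`. -/
noncomputable def reindex (τ : ℕ → ℕ) (z : EuclideanSpace ℝ (Fin m)) : EuclideanSpace ℝ (Fin m) :=
  WithLp.toLp 2 fun k => zeroExtend z (τ k)

theorem zeroExtend_val (z : EuclideanSpace ℝ (Fin m)) (k : Fin m) : zeroExtend z k = z k := by
  simp [zeroExtend]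

theorem measurable_zeroExtend (k : ℕ) :
    Measurable fun z : EuclideanSpace ℝ (Fin m) => zeroExtend z k := by
  unfold zeroExtend
  split_ifs <;> fun_prop

@[fun_prop]
theorem measurable_walk (k : ℕ) : Measurable fun z : EuclideanSpace ℝ (Fin m) => walk z k :=
  Finset.measurable_sum _ fun a _ => measurable_zeroExtend a

theorem walk_zero (z : EuclideanSpace ℝ (Fin m)) : walk z 0 = 0 := by simp [walk]

theorem walk_succ (z : EuclideanSpace ℝ (Fin m)) (k : ℕ) :
    walk z (k + 1) = walk z k + zeroExtend z k := Finset.sum_range_succ _ _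

/-- `τ` restricts to a permutation of the coordinates, whose adjoint is the inverse permutation. -/
theorem measurePreserving_reindex (τ : ℕ → ℕ) (hmaps : ∀ k < m, τ k < m)
    (hinj : ∀ a < m, ∀ b < m, τ a = τ b → a = b) :
    MeasurePreserving (reindex (m := m) τ) (stdGaussian (EuclideanSpace ℝ (Fin m)))
      (stdGaussian (EuclideanSpace ℝ (Fin m))) := by
  have hσ : Function.Injective fun k : Fin m => (⟨τ k, hmaps k k.2⟩ : Fin m) := fun a b hab =>
    Fin.ext (hinj a a.2 b b.2 (Fin.mk.inj_iff.1 hab))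
  let σ : Fin m ≃ Fin m := Equiv.ofBijective _ (Finite.injective_iff_bijective.1 hσ)
  have happ : ∀ (z : EuclideanSpace ℝ (Fin m)) k, reindex τ z k = z (σ k) := fun z k => by
    simp [reindex, zeroExtend, hmaps k k.2, σ]
  refine measurePreserving_stdGaussian_of_inner _
    (fun t => WithLp.toLp 2 fun k => t (σ.symm k)) ?_ ?_ ?_
  · have h1 : Measurable fun z : EuclideanSpace ℝ (Fin m) =>
        fun k : Fin m => zeroExtend z (τ k) :=
      measurable_pi_iff.2 fun k => measurable_zeroExtend _
    exact (by fun_prop : Measurable (WithLp.toLp 2 : (Fin m → ℝ) → _)).comp h1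
  · intro z t
    simp only [PiLp.inner_apply, happ]
    rw [← Equiv.sum_comp σ (fun k => inner ℝ (z k) (t (σ.symm k)))]
    simp
  · intro t
    rw [EuclideanSpace.norm_eq, EuclideanSpace.norm_eq]
    congr 1
    exact Equiv.sum_comp σ.symm (fun k => ‖t k‖ ^ 2)

theorem walk_reindex (τ : ℕ → ℕ) (z : EuclideanSpace ℝ (Fin m)) (W : ℕ → ℝ) (h0 : W 0 = 0)
    (hW : ∀ k < m, W (k + 1) = W k + zeroExtend z (τ k)) :
    ∀ k ≤ m, walk (reindex τ z) k = W k := by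
  intro k
  induction k with
  | zero => intro _; rw [walk_zero, h0]
  | succ k ih =>
    intro hk
    rw [walk_succ, ih (by omega), hW k (by omega)]
    simp [reindex, zeroExtend, show k < m by omega]

/-- The indicator vector of the indices in `[p, q)`. -/
noncomputable def intervalVec (m p q : ℕ) : EuclideanSpace ℝ (Fin m) :=
  WithLp.toLp 2 fun k => if p ≤ (k : ℕ) ∧ (k : ℕ) < q then 1 else 0

theorem sum_fin_interval (f : ℕ → ℝ) {p q : ℕ} (hqm : q ≤ m) :
    ∑ k : Fin m, (if p ≤ (k : ℕ) ∧ (k : ℕ) < q then f k else 0) = ∑ a ∈ Finset.Ico p q, f a := by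
  rw [Fin.sum_univ_eq_sum_range (fun k => if p ≤ k ∧ k < q then f k else 0), ← Finset.sum_filter]
  congr 1
  ext a
  simp only [Finset.mem_filter, Finset.mem_range, Finset.mem_Ico]
  omega

theorem inner_intervalVec (z : EuclideanSpace ℝ (Fin m)) {p q : ℕ} (hpq : p ≤ q) (hqm : q ≤ m) :
    inner ℝ (intervalVec m p q) z = walk z q - walk z p := by
  rw [walk, walk, ← Finset.sum_Ico_eq_sub _ hpq, ← sum_fin_interval _ hqm, PiLp.inner_apply]
  refine Finset.sum_congr rfl fun k _ => ?_
  simp [intervalVec, zeroExtend_val]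

theorem norm_intervalVec_sq {p q : ℕ} (hpq : p ≤ q) (hqm : q ≤ m) :
    ‖intervalVec m p q‖ ^ 2 = (q : ℝ) - p := by
  rw [EuclideanSpace.real_norm_sq_eq]
  have := sum_fin_interval (m := m) (fun _ => 1) (p := p) hqm
  rw [Finset.sum_const, Nat.card_Ico, nsmul_eq_mul, Nat.cast_sub hpq, mul_one] at this
  rw [← this]
  refine Finset.sum_congr rfl fun k _ => ?_
  simp [intervalVec]

theorem integrable_walk_sub_sq {p q : ℕ} (hpq : p ≤ q) (hqm : q ≤ m) :
    Integrable (fun z => (walk z q - walk z p) ^ 2) (stdGaussian (EuclideanSpace ℝ (Fin m))) := by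
  simpa only [inner_intervalVec _ hpq hqm] using
    integrable_inner_sq_stdGaussian (intervalVec m p q)

theorem integral_walk_sub_sq {p q : ℕ} (hpq : p ≤ q) (hqm : q ≤ m) :
    ∫ z, (walk z q - walk z p) ^ 2 ∂(stdGaussian (EuclideanSpace ℝ (Fin m))) = (q : ℝ) - p := by
  simpa only [inner_intervalVec _ hpq hqm, norm_intervalVec_sq hpq hqm] using
    integral_inner_sq_stdGaussian (intervalVec m p q)

end Walk

/-- Almost surely, no increment of the walk over a proper subinterval has the same mean as the
increment over the last `l` steps. -/
theorem ae_walk_mean_ne (N l : ℕ) (hl : 0 < l) :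
    ∀ᵐ z ∂(stdGaussian (EuclideanSpace ℝ (Fin (N + l)))), ∀ p q, p < q → q ≤ N + l →
      (p ≠ N ∨ q ≠ N + l) →
      walk z q - walk z p ≠ (walk z (N + l) - walk z N) / (l : ℝ) * ((q : ℝ) - p) := by
  simp only [ae_all_iff, Filter.eventually_imp_distrib_left]
  intro p q hpq hq hne
  have hl' : (0 : ℝ) < l := by exact_mod_cast hl
  have hpq' : (p : ℝ) < q := by exact_mod_cast hpq
  -- Equality of the two means says that `z` is orthogonal to this vector.
  have ha : (l : ℝ) • intervalVec (N + l) p q - ((q : ℝ) - p) • intervalVec (N + l) N (N + l)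
      ≠ 0 := by
    intro h0
    have hk : ∀ k (hk : k < N + l), (l : ℝ) * (if p ≤ k ∧ k < q then 1 else 0) -
        ((q : ℝ) - p) * (if N ≤ k ∧ k < N + l then 1 else 0) = 0 := by
      intro k hk
      have := congrArg (fun v : EuclideanSpace ℝ (Fin (N + l)) => v ⟨k, hk⟩) h0
      simpa [intervalVec, hk] using this
    -- Each case picks a coordinate covered by only one of the two intervals.
    rcases lt_trichotomy p N with hp | hp | hp
    · have := hk p (by omega)
      rw [if_pos (by omega), if_neg (by omega)] at this
      linarith
    · have := hk (N + l - 1) (by omega)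
      rw [if_neg (by omega), if_pos (by omega)] at this
      linarith
    · have := hk N (by omega)
      rw [if_neg (by omega), if_pos (by omega)] at this
      linarith
  filter_upwards [ae_inner_ne_zero_stdGaussian ha] with z hz heq
  apply hz
  rw [inner_sub_left, real_inner_smul_left, real_inner_smul_left,
    inner_intervalVec _ hpq.le hq, inner_intervalVec _ (by omega) le_rfl, heq]
  field_simp
  ring

theorem measurableSet_isFace {m : ℕ} (i j : ℕ) :
    MeasurableSet {z : EuclideanSpace ℝ (Fin m) | IsFace (walk z) m i j} := by
  have hset : {z : EuclideanSpace ℝ (Fin m) | IsFace (walk z) m i j} =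
      {z | i < j} ∩ ({z | j ≤ m} ∩ ⋂ k, ⋂ (_ : k ≤ m),
        ({z | walk z i + (walk z j - walk z i) / ((j : ℝ) - i) * ((k : ℝ) - i) ≤ walk z k} ∩
          ⋂ (_ : k < i ∨ j < k),
            {z | walk z i + (walk z j - walk z i) / ((j : ℝ) - i) * ((k : ℝ) - i) < walk z k})) := by
    ext z
    simp only [IsFace, Set.mem_inter_iff, Set.mem_iInter, Set.mem_ofPred_eq]
  rw [hset]
  refine (MeasurableSet.const _).inter ((MeasurableSet.const _).inter ?_)
  refine MeasurableSet.iInter fun k => MeasurableSet.iInter fun _ => ?_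
  refine (measurableSet_le (by fun_prop) (by fun_prop)).inter ?_
  exact MeasurableSet.iInter fun _ => measurableSet_lt (by fun_prop) (by fun_prop)

/-! ### Moving and rotating the last steps of a walk -/

/-- The deviation of the walk `S` from its chord over the `l` steps following `N`. -/
noncomputable def bridge (S : ℕ → ℝ) (N l t : ℕ) : ℝ :=
  S (N + t) - S N - (S (N + l) - S N) / (l : ℝ) * t

/-- The walk obtained from `S` by moving the last `l` steps to position `i`. -/
noncomputable def movedWalk (S : ℕ → ℝ) (N l i k : ℕ) : ℝ :=
  if k ≤ i then S k else if k ≤ i + l then S i + (S (N + (k - i)) - S N)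
  else S (k - l) + (S (N + l) - S N)

/-- The walk obtained from `S` by rotating the last `l` steps by `r`. -/
noncomputable def rotatedWalk (S : ℕ → ℝ) (N l r k : ℕ) : ℝ :=
  if k ≤ N then S k else if k + r ≤ N + l then S N + S (k + r) - S (N + r)
  else S (N + l) - S (N + r) + S (k + r - l)

theorem isFace_congr {S S' : ℕ → ℝ} {m i j : ℕ} (h : ∀ k ≤ m, S k = S' k) :
    IsFace S m i j ↔ IsFace S' m i j := by
  unfold IsFace
  refine and_congr_right fun hij => and_congr_right fun hjm => forall₂_congr fun k hk => ?_
  rw [h k hk, h i (by omega), h j hjm]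

/-- Inside the inserted block the face condition concerns only the bridge of the last `l` steps;
outside, the other steps form the first `N` steps of `S` and must stay above a line through `i` with
the mean slope of the block. -/
theorem isFace_movedWalk (S : ℕ → ℝ) {N l i : ℕ} (hl : 0 < l) (hi : i ≤ N) :
    IsFace (movedWalk S N l i) (N + l) i (i + l) ↔ (∀ t ≤ l, 0 ≤ bridge S N l t) ∧
      ∀ k < N + 1, k ≠ i → S i - (S (N + l) - S N) / (l : ℝ) * i <
        S k - (S (N + l) - S N) / (l : ℝ) * k := by
  have hl' : (0 : ℝ) < l := by exact_mod_cast hl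
  have e1 : movedWalk S N l i i = S i := by simp [movedWalk]
  have e2 : movedWalk S N l i (i + l) = S i + (S (N + l) - S N) := by
    simp [movedWalk, hl.ne']
  have hlen : (((i + l : ℕ) : ℝ) - i) = l := by push_cast; ring
  have hc : (S i + (S (N + l) - S N) - S i) / (l : ℝ) = (S (N + l) - S N) / (l : ℝ) := by
    congr 1; ring
  have hcl : (S (N + l) - S N) / (l : ℝ) * l = S (N + l) - S N := by field_simp
  unfold IsFace bridge
  rw [e1, e2, hlen, hc]
  set c := (S (N + l) - S N) / (l : ℝ) with hcdef
  have hmid : ∀ t ≤ l, movedWalk S N l i (i + t) = S i + (S (N + t) - S N) := by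
    intro t ht
    rcases Nat.eq_zero_or_pos t with rfl | h0
    · simp [movedWalk]
    · simp [movedWalk, ht, h0.ne']
  have hpre : ∀ k ≤ i, movedWalk S N l i k = S k := fun k hk => by simp [movedWalk, hk]
  have hpost : ∀ k, i < k → movedWalk S N l i (k + l) = S k + (S (N + l) - S N) := fun k hk => by
    rw [movedWalk, if_neg (by omega), if_neg (by omega), Nat.add_sub_cancel]
  constructor
  · rintro ⟨-, -, h⟩
    refine ⟨fun t ht => ?_, fun k hk hne => ?_⟩
    · have := (h (i + t) (by omega)).1
      rw [hmid t ht] at this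
      push_cast at this
      linarith
    · rcases lt_or_gt_of_ne hne with hlt | hlt
      · have := (h k (by omega)).2 (Or.inl hlt)
        rw [hpre k hlt.le] at this
        linarith
      · have := (h (k + l) (by omega)).2 (Or.inr (by omega))
        rw [hpost k hlt] at this
        push_cast at this
        linarith
  · rintro ⟨h1, h2⟩
    have hstrict : ∀ k ≤ N + l, (k < i ∨ i + l < k) →
        S i + c * ((k : ℝ) - i) < movedWalk S N l i k := by
      rintro k hk (hlt | hlt)
      · have := h2 k (by omega) (by omega)
        rw [hpre k hlt.le]
        linarith
      · obtain ⟨k, rfl⟩ : ∃ k', k = k' + l := ⟨k - l, by omega⟩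
        have := h2 k (by omega) (by omega)
        rw [hpost k (by omega)]
        push_cast
        linarith
    refine ⟨by omega, by omega, fun k hk => ⟨?_, hstrict k hk⟩⟩
    by_cases hout : k < i ∨ i + l < k
    · exact (hstrict k hk hout).le
    · obtain ⟨t, rfl⟩ : ∃ t, k = i + t := ⟨k - i, by omega⟩
      have := h1 t (by omega)
      rw [hmid t (by omega)]
      push_cast
      linarith

/-- The bridge vanishes at both ends, so it is periodic; rotating by `r` shifts its origin to `r`
and subtracts its value there. -/
theorem bridge_rotatedWalk (S : ℕ → ℝ) {N l r : ℕ} (hr : r < l) :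
    (∀ t ≤ l, 0 ≤ bridge (rotatedWalk S N l r) N l t) ↔
      ∀ k < l, bridge S N l r ≤ bridge S N l k := by
  have hl' : (0 : ℝ) < l := by exact_mod_cast (by omega : 0 < l)
  have hN : rotatedWalk S N l r N = S N := by simp [rotatedWalk]
  have h1 : ∀ t, t + r ≤ l → rotatedWalk S N l r (N + t) = S N + S (N + (t + r)) - S (N + r) := by
    intro t ht
    rcases Nat.eq_zero_or_pos t with rfl | h0
    · simp [rotatedWalk]
    · rw [rotatedWalk, if_neg (by omega), if_pos (by omega), add_assoc]
  have h2 : ∀ t, l < t + r →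
      rotatedWalk S N l r (N + t) = S (N + l) - S (N + r) + S (N + (t + r - l)) := by
    intro t ht
    rw [rotatedWalk, if_neg (by omega), if_neg (by omega)]
    congr 2
    omega
  have hNl : rotatedWalk S N l r (N + l) = S (N + l) := by
    rcases Nat.eq_zero_or_pos r with rfl | h0
    · rw [h1 l (by omega)]; simp
    · rw [h2 l (by omega), show l + r - l = r by omega]; ring
  have hcl : (S (N + l) - S N) / (l : ℝ) * l = S (N + l) - S N := by field_simp
  unfold bridge
  rw [hN, hNl]
  set c := (S (N + l) - S N) / (l : ℝ) with hcdef
  constructor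
  · intro h k hk
    by_cases hkr : r ≤ k
    · have := h (k - r) (by omega)
      rw [h1 _ (by omega), Nat.sub_add_cancel hkr, Nat.cast_sub hkr] at this
      linarith
    · have := h (k + l - r) (by omega)
      by_cases hk0 : k = 0
      · subst hk0
        rw [h1 _ (by omega), Nat.sub_add_cancel (by omega), Nat.cast_sub (by omega)] at this
        push_cast at this ⊢
        simp only [zero_add, add_zero] at this ⊢
        linarith
      · rw [h2 _ (by omega), show k + l - r + r - l = k by omega, Nat.cast_sub (by omega)] at this
        push_cast at this
        linarith
  · intro h t ht
    by_cases htr : t + r ≤ l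
    · rw [h1 t htr]
      -- The hypothesis covers only `k < l`; at `t + r = l` the bridge takes its value at `0`.
      rcases htr.eq_or_lt with heq | hlt
      · have := h 0 (by omega)
        have hcast : (t : ℝ) = l - r := by rw [← heq]; push_cast; ring
        rw [heq, hcast]
        simp only [add_zero, Nat.cast_zero, mul_zero] at this
        linarith
      · have := h (t + r) hlt
        push_cast at this
        linarith
    · have := h (t + r - l) (by omega)
      rw [h2 t (by omega)]
      rw [Nat.cast_sub (by omega)] at this
      push_cast at this
      linarith

/-! ### Expected contribution of the faces of a given length -/

section FaceIntegral

variable {N l : ℕ}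

/-- The index map that moves the last `l` of `N + l` positions to position `i`. -/
def moveIndex (N l i k : ℕ) : ℕ :=
  if k < i then k else if k < i + l then N + (k - i) else k - l

/-- The index map that rotates the last `l` of `N + l` positions by `r`. -/
def rotateIndex (N l r k : ℕ) : ℕ :=
  if k < N then k else if k + r < N + l then k + r else k + r - l

theorem measurePreserving_moveIndex {i : ℕ} (hi : i ≤ N) :
    MeasurePreserving (reindex (m := N + l) (moveIndex N l i))
      (stdGaussian (EuclideanSpace ℝ (Fin (N + l))))
      (stdGaussian (EuclideanSpace ℝ (Fin (N + l)))) := by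
  refine measurePreserving_reindex _ (fun k hk => ?_) (fun a ha b hb => ?_) <;>
    unfold moveIndex <;> split_ifs <;> omega

theorem measurePreserving_rotateIndex {r : ℕ} (hr : r < l) :
    MeasurePreserving (reindex (m := N + l) (rotateIndex N l r))
      (stdGaussian (EuclideanSpace ℝ (Fin (N + l))))
      (stdGaussian (EuclideanSpace ℝ (Fin (N + l)))) := by
  refine measurePreserving_reindex _ (fun k hk => ?_) (fun a ha b hb => ?_) <;>
    unfold rotateIndex <;> split_ifs <;> omega

theorem walk_moveIndex (z : EuclideanSpace ℝ (Fin (N + l))) {i : ℕ} (hl : 0 < l) :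
    ∀ k ≤ N + l, walk (reindex (moveIndex N l i) z) k = movedWalk (walk z) N l i k := by
  refine walk_reindex _ z _ (by simp [movedWalk, walk_zero]) fun k hk => ?_
  unfold movedWalk moveIndex
  rcases lt_trichotomy k i with h | h | h
  · rw [if_pos (by omega), if_pos (by omega), if_pos h, walk_succ]
  · subst h
    rw [if_neg (by omega), if_pos (by omega), if_pos le_rfl, if_neg (by omega), if_pos (by omega),
      show k + 1 - k = 0 + 1 by omega, Nat.sub_self, ← add_assoc, walk_succ]
    simp
  · rw [if_neg (show ¬ k + 1 ≤ i by omega), if_neg (show ¬ k ≤ i by omega),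
      if_neg (show ¬ k < i by omega)]
    by_cases h2 : k < i + l
    · rw [if_pos (show k + 1 ≤ i + l by omega), if_pos h2.le, if_pos h2,
        show k + 1 - i = (k - i) + 1 by omega, ← add_assoc, walk_succ]
      ring
    · rw [if_neg (show ¬ k + 1 ≤ i + l by omega), if_neg h2,
        show k + 1 - l = (k - l) + 1 by omega, walk_succ]
      by_cases h3 : k ≤ i + l
      · rw [if_pos h3, show k - i = l by omega, show k - l = i by omega]
        ring
      · rw [if_neg h3]
        ring

theorem walk_rotateIndex (z : EuclideanSpace ℝ (Fin (N + l))) {r : ℕ} (hr : r < l) :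
    ∀ k ≤ N + l, walk (reindex (rotateIndex N l r) z) k = rotatedWalk (walk z) N l r k := by
  refine walk_reindex _ z _ (by simp [rotatedWalk, walk_zero]) fun k hk => ?_
  unfold rotatedWalk rotateIndex
  by_cases h1 : k < N
  · rw [if_pos (by omega), if_pos (by omega), if_pos h1, walk_succ]
  rw [if_neg (by omega), if_neg h1]
  by_cases h2 : k + r < N + l
  · rw [if_pos (by omega), if_pos h2, if_pos h2.le, show k + 1 + r = k + r + 1 by omega, walk_succ]
    by_cases h3 : k ≤ N
    · rw [if_pos h3, show k = N by omega]
      ring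
    · rw [if_neg h3]
      ring
  · rw [if_neg (by omega), if_neg h2, if_neg (by omega),
      show k + 1 + r - l = (k + r - l) + 1 by omega, walk_succ]
    by_cases h3 : k + r ≤ N + l
    · rw [if_pos h3, show k + r - l = N by omega, show k + r = N + l by omega]
      ring
    · rw [if_neg h3]
      ring

theorem integrable_ite_walk {m i j : ℕ} (hij : i ≤ j) (hjm : j ≤ m) (x : ℝ)
    {P : EuclideanSpace ℝ (Fin m) → Prop} [DecidablePred P] (hP : MeasurableSet {z | P z}) :
    Integrable (fun z => if P z then (walk z j - walk z i) ^ 2 / x else 0)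
      (stdGaussian (EuclideanSpace ℝ (Fin m))) := by
  refine (((integrable_walk_sub_sq hij hjm).div_const x).indicator hP).congr
    (Filter.Eventually.of_forall fun z => ?_)
  simp [Set.indicator_apply]

theorem measurableSet_bridge_nonneg :
    MeasurableSet {z : EuclideanSpace ℝ (Fin (N + l)) | ∀ t ≤ l, 0 ≤ bridge (walk z) N l t} := by
  have hset : {z : EuclideanSpace ℝ (Fin (N + l)) | ∀ t ≤ l, 0 ≤ bridge (walk z) N l t} =
      ⋂ t, ⋂ (_ : t ≤ l), {z | 0 ≤ bridge (walk z) N l t} := by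
    ext z
    simp only [Set.mem_iInter, Set.mem_ofPred_eq]
  rw [hset]
  refine MeasurableSet.iInter fun t => MeasurableSet.iInter fun _ => ?_
  unfold bridge
  exact measurableSet_le (by fun_prop) (by fun_prop)

open Classical in
/-- Cyclic rotation: on average over the last `l` steps, exactly one rotation stays above its
chord. -/
theorem integral_bridge_nonneg (hl : 0 < l) :
    ∫ z, (if ∀ t ≤ l, 0 ≤ bridge (walk z) N l t then (walk z (N + l) - walk z N) ^ 2 / (l : ℝ)
      else 0) ∂(stdGaussian (EuclideanSpace ℝ (Fin (N + l)))) = 1 / (l : ℝ) := by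
  set F : EuclideanSpace ℝ (Fin (N + l)) → ℝ := fun z =>
    if ∀ t ≤ l, 0 ≤ bridge (walk z) N l t then (walk z (N + l) - walk z N) ^ 2 / (l : ℝ) else 0
    with hF
  have hl' : (0 : ℝ) < l := by exact_mod_cast hl
  have hint : Integrable F (stdGaussian _) :=
    integrable_ite_walk (Nat.le_add_right N l) le_rfl _ measurableSet_bridge_nonneg
  have hrot : ∀ r < l, ∫ z, F (reindex (rotateIndex N l r) z) ∂(stdGaussian _) =
      ∫ z, F z ∂(stdGaussian _) := fun r hr => by
    have hmp := measurePreserving_rotateIndex (N := N) hr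
    rw [← integral_map hmp.measurable.aemeasurable (by
      rw [hmp.map_eq]; exact hint.aestronglyMeasurable), hmp.map_eq]
  -- Almost surely one rotation survives, so the sum of the integrands is the squared increment over
  -- `l`, of mean one.
  have hsum : ∑ r ∈ Finset.range l, ∫ z, F (reindex (rotateIndex N l r) z) ∂(stdGaussian _) = 1 := by
    rw [← integral_finsetSum]
    · have hval := integral_walk_sub_sq (m := N + l) (Nat.le_add_right N l) le_rfl
      have : ∫ z, (walk z (N + l) - walk z N) ^ 2 / (l : ℝ)
          ∂(stdGaussian (EuclideanSpace ℝ (Fin (N + l)))) = 1 := by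
        rw [integral_div, hval]
        push_cast
        rw [add_sub_cancel_left, div_self hl'.ne']
      rw [← this]
      refine integral_congr_ae ?_
      filter_upwards [ae_walk_mean_ne N l hl] with z hz
      rw [← sum_ite_argmin (bridge (walk z) N l) hl ?_ ((walk z (N + l) - walk z N) ^ 2 / (l : ℝ))]
      · refine Finset.sum_congr rfl fun r hr => ?_
        rw [Finset.mem_range] at hr
        have hw := walk_rotateIndex (N := N) z hr
        have hb : ∀ t ≤ l, bridge (walk (reindex (rotateIndex N l r) z)) N l t =
            bridge (rotatedWalk (walk z) N l r) N l t := fun t ht => by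
          unfold bridge
          rw [hw _ (by omega), hw _ (by omega), hw _ (by omega)]
        have hiff : (∀ t ≤ l, 0 ≤ bridge (walk (reindex (rotateIndex N l r) z)) N l t) ↔
            ∀ k < l, bridge (walk z) N l r ≤ bridge (walk z) N l k := by
          rw [← bridge_rotatedWalk (walk z) hr]
          exact forall₂_congr fun t ht => by rw [hb t ht]
        have hend : walk (reindex (rotateIndex N l r) z) (N + l) = walk z (N + l) := by
          rw [hw _ le_rfl, rotatedWalk, if_neg (by omega)]
          rcases Nat.eq_zero_or_pos r with rfl | h0
          · simp
          · rw [if_neg (by omega), show N + l + r - l = N + r by omega]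
            ring
        have hstart : walk (reindex (rotateIndex N l r) z) N = walk z N := by
          rw [hw _ (by omega), rotatedWalk, if_pos le_rfl]
        simp only [hF, hiff, hend, hstart]
      -- Equal bridge values would give a proper subinterval the mean slope of all the last `l`
      -- steps.
      · have key : ∀ p q, p < q → q < l → bridge (walk z) N l p ≠ bridge (walk z) N l q := by
          intro p q hpq hq heq
          refine hz (N + p) (N + q) (by omega) (by omega) (Or.inr (by omega)) ?_
          unfold bridge at heq
          push_cast
          linarith
        intro p hp q hq heq
        simp only [Finset.coe_range, Set.mem_Iio] at hp hq
        by_contra hne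
        rcases lt_or_gt_of_ne hne with h | h
        · exact key p q h hq heq
        · exact key q p h hp heq.symm
    · intro r hr
      exact (measurePreserving_rotateIndex (Finset.mem_range.1 hr)).integrable_comp_of_integrable
        hint
  rw [Finset.sum_congr rfl fun r hr => hrot r (Finset.mem_range.1 hr), Finset.sum_const,
    Finset.card_range, nsmul_eq_mul] at hsum
  rw [eq_div_iff hl'.ne', mul_comm]
  exact hsum

-- After the move, the bridge event and the increment no longer depend on `i`, and the remaining
-- condition selects one `i` almost surely.
open Classical in
theorem sum_integral_face (hl : 0 < l) :
    ∑ i ∈ Finset.range (N + 1), ∫ z, (if IsFace (walk z) (N + l) i (i + l) then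
      (walk z (i + l) - walk z i) ^ 2 / (l : ℝ) else 0)
      ∂(stdGaussian (EuclideanSpace ℝ (Fin (N + l)))) = 1 / (l : ℝ) := by
  set F : ℕ → EuclideanSpace ℝ (Fin (N + l)) → ℝ := fun i z =>
    if IsFace (walk z) (N + l) i (i + l) then (walk z (i + l) - walk z i) ^ 2 / (l : ℝ) else 0
    with hF
  have hint : ∀ i ≤ N, Integrable (F i) (stdGaussian _) := fun i hi =>
    integrable_ite_walk (Nat.le_add_right i l) (by omega) _ (measurableSet_isFace _ _)
  have hmove : ∀ i ≤ N, ∫ z, F i z ∂(stdGaussian _) =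
      ∫ z, F i (reindex (moveIndex N l i) z) ∂(stdGaussian _) := fun i hi => by
    have hmp := measurePreserving_moveIndex (l := l) hi
    rw [← integral_map hmp.measurable.aemeasurable (by
      rw [hmp.map_eq]; exact (hint i hi).aestronglyMeasurable), hmp.map_eq]
  have hle : ∀ i ∈ Finset.range (N + 1), i ≤ N := fun i hi => by
    have := Finset.mem_range.1 hi
    omega
  rw [Finset.sum_congr rfl fun i hi => hmove i (hle i hi), ← integral_finsetSum,
    ← integral_bridge_nonneg (N := N) hl]
  · refine integral_congr_ae ?_
    filter_upwards [ae_walk_mean_ne N l hl] with z hz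
    set c := (walk z (N + l) - walk z N) / (l : ℝ) with hc
    have hinj : Set.InjOn (fun k : ℕ => walk z k - c * k) (Finset.range (N + 1)) := by
      have key : ∀ p q : ℕ, p < q → q ≤ N → walk z p - c * p ≠ walk z q - c * q := by
        intro p q hpq hq heq
        refine hz p q hpq (by omega) (Or.inr (by omega)) ?_
        linarith
      intro p hp q hq heq
      simp only [Finset.coe_range, Set.mem_Iio] at hp hq
      by_contra hne
      rcases lt_or_gt_of_ne hne with h | h
      · exact key p q h (by omega) heq
      · exact key q p h (by omega) heq.symm
    rw [← sum_ite_argmin (fun k : ℕ => walk z k - c * k) (Nat.succ_pos N) hinj (ite _ _ _)]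
    refine Finset.sum_congr rfl fun i hi => ?_
    have hi' := hle i hi
    have hw := walk_moveIndex z (i := i) hl
    have hiff : IsFace (walk (reindex (moveIndex N l i) z)) (N + l) i (i + l) ↔
        (∀ t ≤ l, 0 ≤ bridge (walk z) N l t) ∧
          ∀ k < N + 1, walk z i - c * i ≤ walk z k - c * k := by
      rw [isFace_congr hw, isFace_movedWalk _ hl hi']
      -- Without ties, strict and weak minimality agree.
      refine and_congr_right fun _ => forall₂_congr fun k hk => ⟨fun h => ?_, fun h hne => ?_⟩
      · by_cases hki : k = i
        · rw [hki]
        · exact (h hki).le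
      · exact lt_of_le_of_ne h fun heq => hne (hinj (by simpa using hk) (by simpa using hi) heq.symm)
    have hinc : walk (reindex (moveIndex N l i) z) (i + l) - walk (reindex (moveIndex N l i) z) i =
        walk z (N + l) - walk z N := by
      rw [hw _ (by omega), hw _ (by omega)]
      simp [movedWalk, hl.ne']
    simp only [hF, hiff, hinc, Nat.succ_eq_add_one]
    split_ifs <;> first | rfl | (exfalso; tauto)
  · intro i hi
    exact (measurePreserving_moveIndex (hle i hi)).integrable_comp_of_integrable (hint i (hle i hi))

end FaceIntegral

/-! ### Projection onto the monotone cone -/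

theorem IsArgmin.unique {α : Type*} {f : α → ℝ} {S : Set α} {x y : α} (hx : IsArgmin f S x)
    (hy : IsArgmin f S y) : x = y := by
  by_contra hne
  exact lt_asymm (hx.2 y hy.1 (Ne.symm hne)) (hy.2 x hx.1 hne)

section Projection

variable {n : ℕ} {C : Set (EuclideanSpace ℝ (Fin n))}

/-- The obtuse angle condition gives `‖w - z‖ ^ 2 ≥ ‖w - p‖ ^ 2 + ‖p - z‖ ^ 2`, hence strict
minimality, which determines the choice in `euclideanProj`. -/
theorem isArgmin_dist_of_inner {z p : EuclideanSpace ℝ (Fin n)} (hp : p ∈ C)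
    (h : ∀ w ∈ C, inner ℝ (z - p) (w - p) ≤ 0) : IsArgmin (fun v => ‖v - z‖) C p := by
  refine ⟨hp, fun w hw hne => ?_⟩
  have hpos : 0 < ‖w - p‖ ^ 2 := by
    have := norm_pos_iff.2 (sub_ne_zero.2 hne)
    positivity
  have hexp : ‖w - z‖ ^ 2 = ‖w - p‖ ^ 2 - 2 * inner ℝ (z - p) (w - p) + ‖p - z‖ ^ 2 := by
    have : w - z = (w - p) - (z - p) := by abel
    rw [this, norm_sub_sq_real, real_inner_comm, norm_sub_rev z p]
  have := h w hw
  exact lt_of_pow_lt_pow_left₀ 2 (norm_nonneg _) (by linarith)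

theorem euclideanProj_eq {z p : EuclideanSpace ℝ (Fin n)}
    (h : IsArgmin (fun v => ‖v - z‖) C p) : euclideanProj C z = p :=
  (Classical.epsilon_spec (p := IsArgmin (fun v => ‖v - z‖) C) ⟨p, h⟩).unique h

theorem euclideanProj_spec (hne : C.Nonempty) (hcl : IsClosed C) (hconv : Convex ℝ C)
    (z : EuclideanSpace ℝ (Fin n)) :
    IsArgmin (fun v => ‖v - z‖) C (euclideanProj C z) ∧
      ∀ w ∈ C, inner ℝ (z - euclideanProj C z) (w - euclideanProj C z) ≤ 0 := by
  obtain ⟨p, hp, hmin⟩ := exists_norm_eq_iInf_of_complete_convex hne hcl.isComplete hconv z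
  rw [norm_eq_iInf_iff_real_inner_le_zero hconv hp] at hmin
  have h := isArgmin_dist_of_inner hp hmin
  rw [euclideanProj_eq h]
  exact ⟨h, hmin⟩

theorem isClosed_monotoneCone (n : ℕ) : IsClosed (monotoneCone n) := by
  have : monotoneCone n = ⋂ a, ⋂ b, ⋂ (_ : a ≤ b), {u | u a ≤ u b} := by
    ext u
    simp only [monotoneCone, Set.mem_iInter, Set.mem_ofPred_eq]
  rw [this]
  exact isClosed_iInter fun a => isClosed_iInter fun b => isClosed_iInter fun _ =>
    isClosed_le (by fun_prop) (by fun_prop)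

theorem convex_monotoneCone (n : ℕ) : Convex ℝ (monotoneCone n) := by
  intro u hu v hv s t hs ht _ a b hab
  have h1 := mul_le_mul_of_nonneg_left (hu a b hab) hs
  have h2 := mul_le_mul_of_nonneg_left (hv a b hab) ht
  simpa using add_le_add h1 h2

theorem zero_mem_monotoneCone (n : ℕ) : 0 ∈ monotoneCone n := fun _ _ _ => le_rfl

theorem smul_mem_monotoneCone {u : EuclideanSpace ℝ (Fin n)} (hu : u ∈ monotoneCone n) {s : ℝ}
    (hs : 0 ≤ s) : s • u ∈ monotoneCone n := fun a b hab => by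
  simpa using mul_le_mul_of_nonneg_left (hu a b hab) hs

/-- The variational inequality is tested on perturbations of `u` by multiples of indicators of
initial segments: lowering is always allowed, raising only for the whole range or up to a jump. -/
theorem isIsotonicFit_euclideanProj (z : EuclideanSpace ℝ (Fin n)) :
    IsIsotonicFit (walk z) (zeroExtend (euclideanProj (monotoneCone n) z)) n := by
  obtain ⟨⟨hu, -⟩, hvar⟩ := euclideanProj_spec ⟨0, zero_mem_monotoneCone n⟩
    (isClosed_monotoneCone n) (convex_monotoneCone n) z
  set u := euclideanProj (monotoneCone n) z
  have hstep : ∀ (s : ℝ) (k : ℕ), k ≤ n → u + s • intervalVec n 0 k ∈ monotoneCone n →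
      s * (walk z k - walk u k) ≤ 0 := by
    intro s k hk hmem
    have := hvar _ hmem
    rwa [add_sub_cancel_left, real_inner_smul_right, real_inner_comm, inner_sub_right,
      inner_intervalVec _ (Nat.zero_le k) hk, inner_intervalVec _ (Nat.zero_le k) hk, walk_zero,
      walk_zero, sub_zero, sub_zero] at this
  have hle : ∀ k ≤ n, walk u k ≤ walk z k := by
    intro k hk
    have := hstep (-1) k hk fun a b hab => by
      have h1 := hu a b hab
      have h2 : (a : ℕ) ≤ b := hab
      simp only [intervalVec, PiLp.add_apply, PiLp.smul_apply, smul_eq_mul]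
      split_ifs <;> first | omega | linarith
    linarith
  refine ⟨?_, walk_zero z, hle, ?_, ?_⟩
  · intro a b hab hb
    have := hu ⟨a, by omega⟩ ⟨b, hb⟩ hab
    simpa [zeroExtend, hb, show a < n by omega] using this
  · refine le_antisymm (hle n le_rfl) ?_
    have := hstep 1 n le_rfl fun a b hab => by
      simpa [intervalVec] using hu a b hab
    change walk z n ≤ walk u n
    linarith
  · intro k hk hlt
    refine le_antisymm (hle _ hk.le) ?_
    have e1 : zeroExtend u k = u ⟨k, by omega⟩ := zeroExtend_val u ⟨k, by omega⟩
    have e2 : zeroExtend u (k + 1) = u ⟨k + 1, hk⟩ := zeroExtend_val u ⟨k + 1, hk⟩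
    rw [e1, e2] at hlt
    -- The size of the jump is the largest amount by which the segment before it can be raised.
    have := hstep (u ⟨k + 1, hk⟩ - u ⟨k, by omega⟩) (k + 1) hk.le fun a b hab => by
      have h1 := hu a b hab
      have h2 : (a : ℕ) ≤ b := hab
      simp only [intervalVec, PiLp.add_apply, PiLp.smul_apply, smul_eq_mul]
      split_ifs
      · linarith
      · have h3 := hu a ⟨k, by omega⟩ (Fin.mk_le_mk.2 (by omega))
        have h4 := hu ⟨k + 1, hk⟩ b (Fin.mk_le_mk.2 (by omega))
        linarith
      · omega
      · linarith
    change walk z (k + 1) ≤ walk u (k + 1)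
    nlinarith

theorem norm_sq_eq_sum_zeroExtend (u : EuclideanSpace ℝ (Fin n)) :
    ‖u‖ ^ 2 = ∑ a ∈ Finset.range n, zeroExtend u a ^ 2 := by
  rw [EuclideanSpace.real_norm_sq_eq, ← Fin.sum_univ_eq_sum_range (fun a => zeroExtend u a ^ 2)]
  simp only [zeroExtend_val]

-- This finite formula also gives integrability, with no separate proof that the projection is
-- measurable.
open Classical in
theorem norm_euclideanProj_monotoneCone_sq (z : EuclideanSpace ℝ (Fin n)) :
    ‖euclideanProj (monotoneCone n) z‖ ^ 2 =
      ∑ l ∈ Finset.Icc 1 n, ∑ i ∈ Finset.range (n - l + 1),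
        if IsFace (walk z) n i (i + l) then (walk z (i + l) - walk z i) ^ 2 / (l : ℝ) else 0 := by
  rw [norm_sq_eq_sum_zeroExtend, (isIsotonicFit_euclideanProj z).sum_sq_eq_sum_faces]

open Classical in
theorem integrable_norm_euclideanProj_monotoneCone_sq (n : ℕ) :
    Integrable (fun z => ‖euclideanProj (monotoneCone n) z‖ ^ 2)
      (stdGaussian (EuclideanSpace ℝ (Fin n))) := by
  simp_rw [norm_euclideanProj_monotoneCone_sq]
  refine integrable_finsetSum _ fun l hl => integrable_finsetSum _ fun i hi => ?_
  rw [Finset.mem_Icc] at hl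
  rw [Finset.mem_range] at hi
  exact integrable_ite_walk (Nat.le_add_right i l) (by omega) _ (measurableSet_isFace _ _)

open Classical in
/-- The statistical dimension of the monotone cone is a harmonic number. -/
theorem statDim_monotoneCone (n : ℕ) :
    statDim (monotoneCone n) = ∑ l ∈ Finset.Icc 1 n, 1 / (l : ℝ) := by
  have hint : ∀ l ∈ Finset.Icc 1 n, ∀ i ∈ Finset.range (n - l + 1), Integrable
      (fun z => if IsFace (walk z) n i (i + l) then (walk z (i + l) - walk z i) ^ 2 / (l : ℝ) else 0)
      (stdGaussian (EuclideanSpace ℝ (Fin n))) := by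
    intro l hl i hi
    rw [Finset.mem_Icc] at hl
    rw [Finset.mem_range] at hi
    exact integrable_ite_walk (Nat.le_add_right i l) (by omega) _ (measurableSet_isFace _ _)
  unfold statDim
  simp_rw [norm_euclideanProj_monotoneCone_sq]
  rw [integral_finsetSum _ fun l hl => integrable_finsetSum _ (hint l hl)]
  refine Finset.sum_congr rfl fun l hl => ?_
  rw [integral_finsetSum _ (hint l hl)]
  rw [Finset.mem_Icc] at hl
  obtain ⟨N, rfl⟩ : ∃ N, n = N + l := ⟨n - l, by omega⟩
  rw [Nat.add_sub_cancel]
  exact sum_integral_face (by omega)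

end Projection

/-! ### Reduction of the block cone to the monotone cone -/

section Block

variable {n m : ℕ} {I : Fin m → Finset (Fin n)}

theorem isClosed_blockMonotoneCone (I : Fin m → Finset (Fin n)) :
    IsClosed (blockMonotoneCone I) := by
  have : blockMonotoneCone I = monotoneCone n ∩
      ⋂ j, ⋂ a, ⋂ (_ : a ∈ I j), ⋂ b, ⋂ (_ : b ∈ I j), {u | u a = u b} := by
    ext u
    simp only [blockMonotoneCone, Set.mem_inter_iff, Set.mem_iInter, Set.mem_ofPred_eq]
  rw [this]
  exact (isClosed_monotoneCone n).inter <| isClosed_iInter fun j => isClosed_iInter fun a =>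
    isClosed_iInter fun _ => isClosed_iInter fun b => isClosed_iInter fun _ =>
      isClosed_eq (by fun_prop) (by fun_prop)

theorem convex_blockMonotoneCone (I : Fin m → Finset (Fin n)) :
    Convex ℝ (blockMonotoneCone I) := by
  intro u hu v hv s t hs ht hst
  refine ⟨convex_monotoneCone n hu.1 hv.1 hs ht hst, fun j a ha b hb => ?_⟩
  simp [hu.2 j a ha b hb, hv.2 j a ha b hb]

theorem zero_mem_blockMonotoneCone (I : Fin m → Finset (Fin n)) : 0 ∈ blockMonotoneCone I :=
  ⟨zero_mem_monotoneCone n, fun _ _ _ _ _ => rfl⟩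

theorem isArgmin_euclideanProj_blockMonotoneCone (I : Fin m → Finset (Fin n))
    (z : EuclideanSpace ℝ (Fin n)) :
    IsArgmin (fun v => ‖v - z‖) (blockMonotoneCone I) (euclideanProj (blockMonotoneCone I) z) :=
  (euclideanProj_spec ⟨0, zero_mem_blockMonotoneCone I⟩ (isClosed_blockMonotoneCone I)
    (convex_blockMonotoneCone I) z).1

namespace IsBlockPartition

theorem nonempty (hI : IsBlockPartition I) (j : Fin m) : (I j).Nonempty := by
  obtain ⟨k, l, hkl, h⟩ := hI.isBlock j
  rw [h]
  exact Finset.nonempty_Icc.2 hkl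

theorem card_pos (hI : IsBlockPartition I) (j : Fin m) : (0 : ℝ) < (I j).card := by
  exact_mod_cast (hI.nonempty j).card_pos

/-- The index of the block containing `a`. -/
noncomputable def index (hI : IsBlockPartition I) (a : Fin n) : Fin m := (hI.cover a).choose

theorem mem_iff (hI : IsBlockPartition I) (a : Fin n) (j : Fin m) : a ∈ I j ↔ hI.index a = j := by
  have hmem : a ∈ I (hI.index a) := (hI.cover a).choose_spec
  refine ⟨fun h => ?_, fun h => h ▸ hmem⟩
  by_contra hne
  rcases lt_or_gt_of_ne hne with hlt | hlt
  · exact lt_irrefl _ (hI.increasing _ _ hlt a hmem a h)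
  · exact lt_irrefl _ (hI.increasing _ _ hlt a h a hmem)

theorem index_mono (hI : IsBlockPartition I) {a b : Fin n} (hab : a ≤ b) :
    hI.index a ≤ hI.index b := by
  by_contra hlt
  exact not_lt.2 hab (hI.increasing _ _ (not_le.1 hlt) b ((hI.mem_iff _ _).2 rfl) a
    ((hI.mem_iff _ _).2 rfl))

theorem sum_eq (hI : IsBlockPartition I) (f : Fin n → ℝ) :
    ∑ a, f a = ∑ j, ∑ a ∈ I j, f a := by
  rw [← Finset.sum_fiberwise Finset.univ hI.index f]
  refine Finset.sum_congr rfl fun j _ => Finset.sum_congr ?_ fun _ _ => rfl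
  ext a
  simp [hI.mem_iff]

/-- The vector that is constant on the blocks with values `x`. -/
noncomputable def blockVec (hI : IsBlockPartition I) (x : EuclideanSpace ℝ (Fin m)) :
    EuclideanSpace ℝ (Fin n) :=
  WithLp.toLp 2 fun a => x (hI.index a)

theorem blockVec_apply (hI : IsBlockPartition I) (x : EuclideanSpace ℝ (Fin m)) {a : Fin n}
    {j : Fin m} (ha : a ∈ I j) : hI.blockVec x a = x j := by
  simp [blockVec, (hI.mem_iff a j).1 ha]

theorem blockVec_mem (hI : IsBlockPartition I) {x : EuclideanSpace ℝ (Fin m)}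
    (hx : x ∈ monotoneCone m) : hI.blockVec x ∈ blockMonotoneCone I :=
  ⟨fun _ _ hab => hx _ _ (hI.index_mono hab), fun j a ha b hb => by
    rw [hI.blockVec_apply x ha, hI.blockVec_apply x hb]⟩

theorem blockVec_injective (hI : IsBlockPartition I) : Function.Injective hI.blockVec := by
  intro x y hxy
  ext j
  obtain ⟨a, ha⟩ := hI.nonempty j
  rw [← hI.blockVec_apply x ha, hxy, hI.blockVec_apply y ha]

theorem exists_blockVec_eq (hI : IsBlockPartition I) {u : EuclideanSpace ℝ (Fin n)}
    (hu : u ∈ blockMonotoneCone I) : ∃ x ∈ monotoneCone m, hI.blockVec x = u := by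
  choose r hr using hI.nonempty
  refine ⟨WithLp.toLp 2 fun j => u (r j), fun i j hij => ?_, ?_⟩
  · rcases hij.eq_or_lt with rfl | hlt
    · exact le_rfl
    · exact hu.1 _ _ (hI.increasing i j hlt _ (hr i) _ (hr j)).le
  · ext a
    have ha : a ∈ I (hI.index a) := (hI.mem_iff _ _).2 rfl
    rw [hI.blockVec_apply _ ha]
    exact hu.2 _ _ (hr _) _ ha

/-- The cross terms vanish blockwise, and the second sum does not involve `x`; so minimizing over
`x` only sees the weighted objective. -/
theorem norm_blockVec_sub_sq (hI : IsBlockPartition I) (x : EuclideanSpace ℝ (Fin m))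
    (z : EuclideanSpace ℝ (Fin n)) :
    ‖hI.blockVec x - z‖ ^ 2 = ∑ j, ((I j).card : ℝ) * (x j - blockMean z (I j)) ^ 2 +
      ∑ j, ∑ a ∈ I j, (blockMean z (I j) - z a) ^ 2 := by
  rw [EuclideanSpace.real_norm_sq_eq, hI.sum_eq, ← Finset.sum_add_distrib]
  refine Finset.sum_congr rfl fun j _ => ?_
  have hmean : ∑ a ∈ I j, (blockMean z (I j) - z a) = 0 := by
    rw [Finset.sum_sub_distrib, Finset.sum_const, nsmul_eq_mul, blockMean]
    have := (hI.card_pos j).ne'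
    field_simp
    ring
  have hterm : ∀ a ∈ I j, (hI.blockVec x - z) a ^ 2 = (x j - blockMean z (I j)) ^ 2 +
      2 * (x j - blockMean z (I j)) * (blockMean z (I j) - z a) +
      (blockMean z (I j) - z a) ^ 2 := by
    intro a ha
    rw [PiLp.sub_apply, hI.blockVec_apply x ha]
    ring
  rw [Finset.sum_congr rfl hterm, Finset.sum_add_distrib, Finset.sum_add_distrib,
    ← Finset.mul_sum, hmean, Finset.sum_const, nsmul_eq_mul]
  ring

theorem exists_isWeightedIsotonicRegression (hI : IsBlockPartition I)
    (z : EuclideanSpace ℝ (Fin n)) :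
    ∃ x : EuclideanSpace ℝ (Fin m),
      IsWeightedIsotonicRegression (fun j => ((I j).card : ℝ)) (fun j => blockMean z (I j)) x ∧
      hI.blockVec x = euclideanProj (blockMonotoneCone I) z := by
  have hproj := isArgmin_euclideanProj_blockMonotoneCone I z
  obtain ⟨x, hx, hxu⟩ := hI.exists_blockVec_eq hproj.1
  refine ⟨x, ⟨hx, fun y hy hne => ?_⟩, hxu⟩
  have hlt := hproj.2 _ (hI.blockVec_mem hy) (by
    rw [← hxu]
    exact fun h => hne (hI.blockVec_injective h))
  rw [← hxu] at hlt
  have hsq := pow_lt_pow_left₀ hlt (norm_nonneg _) two_ne_zero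
  rw [hI.norm_blockVec_sub_sq, hI.norm_blockVec_sub_sq] at hsq
  linarith

/-- The rescaled block sums of a standard Gaussian vector are standard Gaussian if all blocks have
the same size `b`. -/
theorem measurePreserving_scaled_blockMean (hI : IsBlockPartition I) {b : ℝ} (hb : 0 < b)
    (hcard : ∀ j, ((I j).card : ℝ) = b) :
    MeasurePreserving (fun z : EuclideanSpace ℝ (Fin n) =>
        (WithLp.toLp 2 fun j => √b * blockMean z (I j) : EuclideanSpace ℝ (Fin m)))
      (stdGaussian (EuclideanSpace ℝ (Fin n))) (stdGaussian (EuclideanSpace ℝ (Fin m))) := by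
  have hsq : √b * √b = b := Real.mul_self_sqrt hb.le
  have hs : 0 < √b := Real.sqrt_pos.2 hb
  have hcoef : √b * (1 / b) = (√b)⁻¹ := by
    nth_rewrite 2 [← hsq]
    field_simp
  -- The adjoint repeats each coordinate `b` times, and the factor `(√b)⁻¹` makes it isometric.
  refine measurePreserving_stdGaussian_of_inner _ (fun t => (√b)⁻¹ • hI.blockVec t) ?_ ?_ ?_
  · unfold blockMean
    fun_prop
  · intro z t
    rw [real_inner_smul_right, PiLp.inner_apply, PiLp.inner_apply, hI.sum_eq, Finset.mul_sum]
    refine Finset.sum_congr rfl fun j _ => ?_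
    rw [Finset.sum_congr rfl (g := fun a => t j * z a) fun a ha => by
      rw [hI.blockVec_apply t ha]; simp, ← Finset.mul_sum]
    simp only [blockMean, hcard]
    rw [← mul_assoc, hcoef]
    simp
    ring
  · intro t
    have h : ‖(√b)⁻¹ • hI.blockVec t‖ ^ 2 = ‖t‖ ^ 2 := by
      rw [norm_smul, mul_pow, EuclideanSpace.real_norm_sq_eq, EuclideanSpace.real_norm_sq_eq,
        hI.sum_eq, Finset.mul_sum]
      refine Finset.sum_congr rfl fun j _ => ?_
      rw [Finset.sum_congr rfl (g := fun _ => t j ^ 2) fun a ha => by rw [hI.blockVec_apply t ha],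
        Finset.sum_const, nsmul_eq_mul, hcard, norm_inv, Real.norm_of_nonneg hs.le, inv_pow,
        Real.sq_sqrt hb.le]
      field_simp
    exact (pow_left_inj₀ (norm_nonneg _) (norm_nonneg _) two_ne_zero).1 h

/-- Equal weights do not affect the minimizer, projection onto a cone commutes with scaling by `√b`,
and repeating each coordinate `b` times multiplies the squared norm by `b`. -/
theorem norm_euclideanProj_sq_of_card_eq (hI : IsBlockPartition I) {b : ℝ} (hb : 0 < b)
    (hcard : ∀ j, ((I j).card : ℝ) = b) (z : EuclideanSpace ℝ (Fin n)) :
    ‖euclideanProj (blockMonotoneCone I) z‖ ^ 2 =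
      ‖euclideanProj (monotoneCone m) (WithLp.toLp 2 fun j => √b * blockMean z (I j))‖ ^ 2 := by
  have hs : 0 < √b := Real.sqrt_pos.2 hb
  obtain ⟨x, ⟨hx, hmin⟩, hxu⟩ := hI.exists_isWeightedIsotonicRegression z
  have hscale : ∀ y : EuclideanSpace ℝ (Fin m),
      ‖√b • y - (WithLp.toLp 2 fun j => √b * blockMean z (I j) : EuclideanSpace ℝ (Fin m))‖ ^ 2 =
        ∑ j, ((I j).card : ℝ) * (y j - blockMean z (I j)) ^ 2 := by
    intro y
    rw [EuclideanSpace.real_norm_sq_eq]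
    refine Finset.sum_congr rfl fun j _ => ?_
    simp only [PiLp.sub_apply, PiLp.smul_apply, smul_eq_mul]
    rw [← mul_sub, mul_pow, Real.sq_sqrt hb.le, hcard]
  have harg : IsArgmin (fun v => ‖v - (WithLp.toLp 2 fun j => √b * blockMean z (I j) :
      EuclideanSpace ℝ (Fin m))‖) (monotoneCone m) (√b • x) := by
    refine ⟨smul_mem_monotoneCone hx hs.le, fun y hy hne => ?_⟩
    have hy' : y = √b • ((√b)⁻¹ • y) := by rw [smul_inv_smul₀ hs.ne']
    have hlt := hmin _ (smul_mem_monotoneCone hy (inv_nonneg.2 hs.le)) fun h => hne (by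
      rw [← h, smul_inv_smul₀ hs.ne'])
    refine lt_of_pow_lt_pow_left₀ 2 (norm_nonneg _) ?_
    rw [hscale, hy', hscale]
    exact hlt
  rw [euclideanProj_eq harg, ← hxu, norm_smul, mul_pow, Real.norm_of_nonneg hs.le,
    Real.sq_sqrt hb.le, EuclideanSpace.real_norm_sq_eq, EuclideanSpace.real_norm_sq_eq, hI.sum_eq,
    Finset.mul_sum]
  refine Finset.sum_congr rfl fun j _ => ?_
  rw [Finset.sum_congr rfl (g := fun _ => x j ^ 2) fun a ha => by rw [hI.blockVec_apply x ha],
    Finset.sum_const, nsmul_eq_mul, hcard]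

end IsBlockPartition

end Block

theorem lemma4 {n m : ℕ} (I : Fin m → Finset (Fin n)) (hI : IsBlockPartition I) :
    (∀ z : EuclideanSpace ℝ (Fin n),
      IsArgmin (fun v => ‖v - z‖) (blockMonotoneCone I) (euclideanProj (blockMonotoneCone I) z) ∧
      ∃ x : EuclideanSpace ℝ (Fin m),
        IsWeightedIsotonicRegression (fun j => ((I j).card : ℝ)) (fun j => blockMean z (I j)) x ∧
        ∀ j, ∀ i ∈ I j, euclideanProj (blockMonotoneCone I) z i = x j) ∧
    ((∀ i j, (I i).card = (I j).card) →
      Integrable (fun z => ‖euclideanProj (blockMonotoneCone I) z‖ ^ 2)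
        (stdGaussian (EuclideanSpace ℝ (Fin n))) ∧
      statDim (blockMonotoneCone I) = ∑ j ∈ Finset.Icc 1 m, 1 / (j : ℝ)) := by
  refine ⟨fun z => ⟨isArgmin_euclideanProj_blockMonotoneCone I z, ?_⟩, fun hcard => ?_⟩
  · obtain ⟨x, hx, hxu⟩ := hI.exists_isWeightedIsotonicRegression z
    exact ⟨x, hx, fun j i hi => by rw [← hxu, hI.blockVec_apply x hi]⟩
  · obtain ⟨b, hb, hIb⟩ : ∃ b : ℝ, 0 < b ∧ ∀ j, ((I j).card : ℝ) = b := by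
      rcases isEmpty_or_nonempty (Fin m) with h | ⟨⟨j₀⟩⟩
      -- For `m = 0` there is no block size to read off, and any positive `b` serves.
      · exact ⟨1, one_pos, fun j => h.elim j⟩
      · exact ⟨(I j₀).card, hI.card_pos j₀, fun j => by rw [hcard j j₀]⟩
    have hmp := hI.measurePreserving_scaled_blockMean hb hIb
    have hint := integrable_norm_euclideanProj_monotoneCone_sq m
    rw [← statDim_monotoneCone, statDim, statDim]
    simp_rw [hI.norm_euclideanProj_sq_of_card_eq hb hIb]
    refine ⟨hmp.integrable_comp_of_integrable hint, ?_⟩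
    rw [← hmp.map_eq]
    rw [integral_map hmp.measurable.aemeasurable (by
      rw [hmp.map_eq]; exact hint.aestronglyMeasurable)]
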